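/- For a finite group $G$, let $\rho(G)=\prod_{x\in G} o(x)$ be the product of the orders $o(x)$ of its elements, and let $\Omega_\rho(G)=\Omega(\rho(G))$, where $\Omega(n)$ is the number of prime factors of the positive integer $n$ counted with multiplicity. Let $L_2(11)=\mathrm{PSL}(2,11)$ be the projective special linear group of degree $2$ over the field with $11$ elements. Then $\Omega_\rho(L_2(11))=769$, and for every group $G$ of order $660$ one has $\Omega_\rho(G)\ge \Omega_\rho(L_2(11))$; moreover, $\Omega_\rho(G)=769$ if and only if $G\cong L_2(11)$. -/

import Mathlib

/-- `ρ(G) = ∏_{x ∈ G} o(x)`, the product of the orders of all elements of a finite group `G`. -/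
noncomputable def rho (G : Type*) [Group G] [Finite G] : ℕ :=
  ∏ᶠ x : G, orderOf x

/-- `Ω_ρ(G) = Ω(ρ(G))`, where `Ω` counts the prime factors of a natural number
with multiplicity. -/
noncomputable def OmegaRho (G : Type*) [Group G] [Finite G] : ℕ :=
  ArithmeticFunction.cardFactors (rho G)

/-- `L_2(11) = PSL(2, 11) = SL(2, 11) / Z(SL(2, 11))`, over the field with 11 elements. -/
abbrev L2Eleven : Type :=
  Matrix.ProjectiveSpecialLinearGroup (Fin 2) (ZMod 11)

/-! `OmegaRho` is additive over elements, and a nontrivial element contributes 1 if its order is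
prime and at least 2 otherwise. So the value is at least 659 plus the number of elements of
composite order, with equality when no order has three prime factors. In `L2Eleven` the composite
orders are all 6, taken by 110 elements, whence 769.

Conversely, a value of at most 769 allows at most 110 elements of composite order. An element of
order 3 or 5 commuting with one of order 11 would force at least 200 or 120
(`index_mul_le_ncard_composite`). Hence there are twelve Sylow 11-subgroups, each self-centralizing
with normalizer of order 55. The action on them is modelled on the projective line over `ZMod 11`,
with a translation, the homothety by 3 and an involution swapping 0 and ∞. Such an involution must
be the inversion up to a homothety, so the group is isomorphic to one fixed permutation group.
`L2Eleven` meets the same bound, so it is that group too. -/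

/-! ### Additivity and elements of composite order -/

theorem omegaRho_eq_sum (G : Type*) [Group G] [Fintype G] :
    OmegaRho G = ∑ x : G, ArithmeticFunction.cardFactors (orderOf x) := by
  have h : (Multiset.map (fun x : G => orderOf x) Finset.univ.val).prod ≠ 0 :=
    Finset.prod_ne_zero_iff.2 fun x _ => (orderOf_pos x).ne'
  rw [OmegaRho, rho, finprod_eq_prod_of_fintype, Finset.prod,
    ArithmeticFunction.cardFactors_multiset_prod h, Multiset.map_map]
  rfl

theorem omegaRho_congr {G H : Type*} [Group G] [Finite G] [Group H] [Finite H] (e : G ≃* H) :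
    OmegaRho G = OmegaRho H := by
  have := Fintype.ofFinite G
  have := Fintype.ofFinite H
  rw [omegaRho_eq_sum, omegaRho_eq_sum]
  exact Fintype.sum_equiv e.toEquiv _ _ fun x => by
    simp [MulEquiv.orderOf_eq]

theorem omegaRho_eq_sum_erase (G : Type*) [Group G] [Fintype G] [DecidableEq G] :
    OmegaRho G = ∑ x ∈ Finset.univ.erase (1 : G), ArithmeticFunction.cardFactors (orderOf x) := by
  rw [omegaRho_eq_sum, ← Finset.add_sum_erase _ _ (Finset.mem_univ (1 : G))]
  simp

theorem card_add_ncard_eq_sum_erase (G : Type*) [Group G] [Fintype G] [DecidableEq G] :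
    Nat.card G + {x : G | 2 ≤ ArithmeticFunction.cardFactors (orderOf x)}.ncard =
      ∑ x ∈ Finset.univ.erase (1 : G),
        (1 + if 2 ≤ ArithmeticFunction.cardFactors (orderOf x) then 1 else 0) + 1 := by
  rw [Set.ncard_eq_toFinset_card', Nat.card_eq_fintype_card, ← Finset.card_univ,
    Finset.card_eq_sum_ones, Set.toFinset_ofPred, Finset.card_filter, ← Finset.sum_add_distrib,
    ← Finset.add_sum_erase _ _ (Finset.mem_univ (1 : G)), add_comm]
  simp

/-- Every nontrivial element contributes at least one prime factor to `ρ(G)`, and every element of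
composite order at least one more. -/
theorem card_add_ncard_le_omegaRho (G : Type*) [Group G] [Finite G] :
    Nat.card G + {x : G | 2 ≤ ArithmeticFunction.cardFactors (orderOf x)}.ncard ≤
      OmegaRho G + 1 := by
  classical
  have := Fintype.ofFinite G
  rw [omegaRho_eq_sum_erase, card_add_ncard_eq_sum_erase]
  gcongr with x hx
  have h1 : 1 < orderOf x := by
    have := orderOf_pos x
    have : orderOf x ≠ 1 := fun h => (Finset.mem_erase.1 hx).1 (orderOf_eq_one_iff.1 h)
    omega
  have := ArithmeticFunction.cardFactors_pos_iff_one_lt.2 h1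
  split_ifs <;> omega

theorem omegaRho_add_one_le_card_add_ncard (G : Type*) [Group G] [Finite G]
    (h : ∀ x : G, ArithmeticFunction.cardFactors (orderOf x) ≤ 2) :
    OmegaRho G + 1 ≤
      Nat.card G + {x : G | 2 ≤ ArithmeticFunction.cardFactors (orderOf x)}.ncard := by
  classical
  have := Fintype.ofFinite G
  rw [omegaRho_eq_sum_erase, card_add_ncard_eq_sum_erase]
  gcongr with x
  have := h x
  split_ifs <;> omega

/-! ### Element orders in PSL(2, 11) -/

open Matrix

/-- By Cayley–Hamilton, the powers of a `2 × 2` matrix of determinant one are combinations of the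
matrix and the identity, with Chebyshev coefficients in the trace. -/
def chebU {R : Type*} [CommRing R] (τ : R) : ℕ → R
  | 0 => 0
  | 1 => 1
  | n + 2 => τ * chebU τ (n + 1) - chebU τ n

theorem pow_succ_eq_chebU {R : Type*} [CommRing R] (A : Matrix (Fin 2) (Fin 2) R)
    (hA : A.det = 1) (n : ℕ) :
    A ^ (n + 1) = chebU A.trace (n + 1) • A - chebU A.trace n • (1 : Matrix (Fin 2) (Fin 2) R) := by
  induction n with
  | zero => simp [chebU]
  | succ n ih =>
    have h2 : A * A = A.trace • A - 1 := by
      rw [det_fin_two] at hA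
      ext i j
      fin_cases i <;> fin_cases j <;>
        simp [Matrix.mul_apply, Fin.sum_univ_two, trace_fin_two] <;>
          first | ring1 | linear_combination -hA
    rw [pow_succ, ih, sub_mul, smul_mul_assoc, h2, smul_mul_assoc, one_mul, chebU, sub_smul,
      mul_comm, mul_smul, smul_sub]
    abel

instance : Fact (Nat.Prime 11) := ⟨by norm_num⟩

theorem SL2.mem_center_iff {K : Type*} [Field K] (A : SpecialLinearGroup (Fin 2) K) :
    A ∈ Subgroup.center (SpecialLinearGroup (Fin 2) K) ↔
      A.1 0 1 = 0 ∧ A.1 1 0 = 0 ∧ A.1 0 0 = A.1 1 1 := by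
  rw [Matrix.SpecialLinearGroup.mem_center_iff]
  constructor
  · rintro ⟨r, -, hr⟩
    simp [← hr]
  · rintro ⟨h1, h2, h3⟩
    have hd := A.2
    rw [det_fin_two] at hd
    refine ⟨A.1 0 0, ?_, ?_⟩
    · rw [Fintype.card_fin]
      rw [h1, ← h3] at hd
      linear_combination hd
    · ext i j
      fin_cases i <;> fin_cases j <;> simp [h1, h2, h3]

/-- A combination of `A` and the identity is scalar only if `A` is scalar or its coefficient
vanishes. So the trace alone determines the order of a noncentral element modulo the center. -/
theorem SL2.pow_mem_center_iff {K : Type*} [Field K] (A : SpecialLinearGroup (Fin 2) K) (n : ℕ) :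
    A ^ (n + 1) ∈ Subgroup.center (SpecialLinearGroup (Fin 2) K) ↔
      chebU A.1.trace (n + 1) = 0 ∨ A ∈ Subgroup.center (SpecialLinearGroup (Fin 2) K) := by
  have h : (A ^ (n + 1)).1 = _ := pow_succ_eq_chebU A.1 A.2 n
  rw [SL2.mem_center_iff, SL2.mem_center_iff, h]
  simp
  tauto

/-- The nontrivial classes of `PSL(2, 11)` have prime order, except those of trace `τ` with
`τ ^ 2 = 3`, which have order six. -/
theorem cardFactors_orderOf_l2Eleven (A : SpecialLinearGroup (Fin 2) (ZMod 11)) :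
    ArithmeticFunction.cardFactors (orderOf (A : L2Eleven)) ≤ 2 ∧
      (2 ≤ ArithmeticFunction.cardFactors (orderOf (A : L2Eleven)) ↔ A.1.trace ^ 2 = 3) := by
  have hpow : ∀ n, (A : L2Eleven) ^ (n + 1) = 1 ↔
      chebU A.1.trace (n + 1) = 0 ∨ (A : L2Eleven) = 1 := fun n => by
    rw [← QuotientGroup.mk_pow, QuotientGroup.eq_one_iff, QuotientGroup.eq_one_iff,
      SL2.pow_mem_center_iff]
  by_cases h1 : (A : L2Eleven) = 1
  · have ht : A.1.trace ^ 2 ≠ 3 := by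
      obtain ⟨h01, h10, h00⟩ := (SL2.mem_center_iff A).1 ((QuotientGroup.eq_one_iff A).1 h1)
      have hd := A.2
      rw [det_fin_two, h01, h00, zero_mul] at hd
      rw [trace_fin_two, h00]
      generalize A.1 1 1 = a at hd
      revert hd
      revert a
      decide
    rw [h1, orderOf_one, ArithmeticFunction.cardFactors_one]
    simp [ht]
  · simp only [h1, or_false] at hpow
    by_cases ht : A.1.trace ^ 2 = 3
    · have h6 : orderOf (A : L2Eleven) = 2 * 3 := by
        have key : ∀ τ : ZMod 11, τ ^ 2 = 3 →
            chebU τ 6 = 0 ∧ chebU τ 3 ≠ 0 ∧ chebU τ 2 ≠ 0 := by decide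
        obtain ⟨k6, k3, k2⟩ := key _ ht
        refine orderOf_eq_of_pow_and_pow_div_prime (by norm_num) ((hpow 5).2 k6) fun p hp hd => ?_
        rcases (Nat.Prime.dvd_mul hp).1 hd with hd | hd
        · rw [(Nat.prime_dvd_prime_iff_eq hp Nat.prime_two).1 hd]
          exact fun h => k3 ((hpow 2).1 h)
        · rw [(Nat.prime_dvd_prime_iff_eq hp Nat.prime_three).1 hd]
          exact fun h => k2 ((hpow 1).1 h)
      rw [h6, ArithmeticFunction.cardFactors_mul (by norm_num) (by norm_num),
        ArithmeticFunction.cardFactors_apply_prime Nat.prime_two,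
        ArithmeticFunction.cardFactors_apply_prime Nat.prime_three]
      simp [ht]
    -- The remaining values of `τ ^ 2` are 0, 1, {5, 9} and 4, giving orders 2, 3, 5 and 11.
    · have key : ∀ τ : ZMod 11, τ ^ 2 ≠ 3 →
          chebU τ 2 = 0 ∨ chebU τ 3 = 0 ∨ chebU τ 5 = 0 ∨ chebU τ 11 = 0 := by decide
      have hp : (orderOf (A : L2Eleven)).Prime := by
        have aux : ∀ n, (n + 1).Prime → chebU A.1.trace (n + 1) = 0 →
            (orderOf (A : L2Eleven)).Prime := fun n hn h0 => by
          have := Fact.mk hn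
          rwa [orderOf_eq_prime ((hpow n).2 h0) h1]
        rcases key _ ht with h | h | h | h
        exacts [aux 1 (by norm_num) h, aux 2 (by norm_num) h, aux 4 (by norm_num) h,
          aux 10 (by norm_num) h]
      rw [ArithmeticFunction.cardFactors_apply_prime hp]
      simp [ht]

/-! ### Counting in SL(2, 11) and the value 769 -/

def sl2Equiv (R : Type*) [CommRing R] : SpecialLinearGroup (Fin 2) R ≃
    {x : R × R × R × R // x.1 * x.2.1 - x.2.2.1 * x.2.2.2 = 1} where
  toFun A := ⟨(A.1 0 0, A.1 1 1, A.1 0 1, A.1 1 0), by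
    rw [← det_fin_two]; exact A.2⟩
  invFun x := ⟨!![x.1.1, x.1.2.2.1; x.1.2.2.2, x.1.2.1], by
    rw [det_fin_two]; exact x.2⟩
  left_inv A := by
    ext i j
    fin_cases i <;> fin_cases j <;> rfl
  right_inv x := rfl

/-- Each of the ten nonzero first factors determines the second; a zero first factor allows eleven
second factors if `s = 1` and none otherwise. -/
theorem card_mul_eq (s : ZMod 11) :
    ∑ y : ZMod 11 × ZMod 11, (if s - y.1 * y.2 = 1 then 1 else 0) = if s = 1 then 21 else 10 := by
  have hrow : ∀ b : ZMod 11, b ≠ 0 → ∑ c : ZMod 11, (if s - b * c = 1 then 1 else 0) = 1 :=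
    fun b hb => by
      have : ∀ c, s - b * c = 1 ↔ c = b⁻¹ * (s - 1) := fun c => by
        rw [eq_inv_mul_iff_mul_eq₀ hb, sub_eq_iff_eq_add', eq_sub_iff_add_eq, eq_comm]
      simp only [this, Finset.sum_ite_eq', Finset.mem_univ, if_true]
  rw [Fintype.sum_prod_type, ← Finset.add_sum_erase _ _ (Finset.mem_univ 0),
    Finset.sum_congr rfl fun b hb => hrow b (Finset.ne_of_mem_erase hb), Finset.sum_const,
    Finset.card_erase_of_mem (Finset.mem_univ _), Finset.card_univ, ZMod.card]
  split_ifs with h1 <;> simp [h1, ZMod.card]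

/-- Summing out the off-diagonal entries leaves only 121 diagonal pairs, few enough for kernel
evaluation. -/
theorem card_sl2Eleven_diag (P : ZMod 11 → ZMod 11 → Prop) [∀ a d, Decidable (P a d)] :
    Nat.card {A : SpecialLinearGroup (Fin 2) (ZMod 11) // P (A.1 0 0) (A.1 1 1)} =
      ∑ a : ZMod 11, ∑ d : ZMod 11, if P a d then (if a * d = 1 then 21 else 10) else 0 := by
  have e : {A : SpecialLinearGroup (Fin 2) (ZMod 11) // P (A.1 0 0) (A.1 1 1)} ≃
      {x : ZMod 11 × ZMod 11 × ZMod 11 × ZMod 11 //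
        x.1 * x.2.1 - x.2.2.1 * x.2.2.2 = 1 ∧ P x.1 x.2.1} :=
    ((sl2Equiv (ZMod 11)).subtypeEquiv (q := fun x => P x.1.1 x.1.2.1) fun A => Iff.rfl).trans
      (Equiv.subtypeSubtypeEquivSubtypeInter _
        (fun x : ZMod 11 × ZMod 11 × ZMod 11 × ZMod 11 => P x.1 x.2.1))
  rw [Nat.card_congr e, Nat.card_eq_fintype_card, Fintype.card_subtype, Finset.card_filter,
    Fintype.sum_prod_type]
  refine Finset.sum_congr rfl fun a _ => ?_
  rw [Fintype.sum_prod_type]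
  refine Finset.sum_congr rfl fun d _ => ?_
  split_ifs with hP h1
  · simpa [hP, h1] using card_mul_eq (a * d)
  · simpa [hP, h1] using card_mul_eq (a * d)
  · simp [hP]

theorem card_sl2Eleven : Nat.card (SpecialLinearGroup (Fin 2) (ZMod 11)) = 1320 := by
  rw [← Nat.card_congr (Equiv.subtypeUnivEquiv (fun _ => trivial)),
    card_sl2Eleven_diag fun _ _ => True]
  decide +kernel

theorem card_trace_sq_eq_three :
    Nat.card {A : SpecialLinearGroup (Fin 2) (ZMod 11) | A.1.trace ^ 2 = 3} = 220 := by
  have h : Nat.card {A : SpecialLinearGroup (Fin 2) (ZMod 11) // (A.1 0 0 + A.1 1 1) ^ 2 = 3} =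
      220 := by
    rw [card_sl2Eleven_diag fun a d => (a + d) ^ 2 = 3]
    decide +kernel
  rw [← h]
  exact Nat.card_congr (Equiv.subtypeEquivRight fun A => by
    rw [Set.mem_ofPred_eq, trace_fin_two])

theorem card_center_sl2Eleven :
    Nat.card (Subgroup.center (SpecialLinearGroup (Fin 2) (ZMod 11))) = 2 := by
  have e : Subgroup.center (SpecialLinearGroup (Fin 2) (ZMod 11)) ≃
      {x : ZMod 11 // x * x = 1} :=
    { toFun := fun A => ⟨A.1.1 0 0, by
        obtain ⟨h01, -, h00⟩ := (SL2.mem_center_iff A.1).1 A.2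
        have hd := A.1.2
        rwa [det_fin_two, h01, ← h00, zero_mul, sub_zero] at hd⟩
      invFun := fun x => ⟨⟨!![x.1, 0; 0, x.1], by rw [det_fin_two]; simpa using x.2⟩,
        (SL2.mem_center_iff _).2 ⟨rfl, rfl, rfl⟩⟩
      left_inv := fun A => by
        obtain ⟨h01, h10, h00⟩ := (SL2.mem_center_iff A.1).1 A.2
        ext i j
        fin_cases i <;> fin_cases j
        exacts [rfl, h01.symm, h10.symm, h00]
      right_inv := fun x => rfl }
  rw [Nat.card_congr e, Nat.card_eq_fintype_card, Fintype.card_subtype]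
  decide +kernel

theorem card_l2Eleven : Nat.card L2Eleven = 660 := by
  have := Subgroup.card_eq_card_quotient_mul_card_subgroup
    (Subgroup.center (SpecialLinearGroup (Fin 2) (ZMod 11)))
  rw [card_sl2Eleven, card_center_sl2Eleven] at this
  change 1320 = Nat.card L2Eleven * 2 at this
  omega

theorem omegaRho_l2Eleven : OmegaRho L2Eleven = 769 := by
  have h1 := card_add_ncard_le_omegaRho L2Eleven
  have h2 := omegaRho_add_one_le_card_add_ncard L2Eleven fun x => by
    obtain ⟨A, rfl⟩ := QuotientGroup.mk_surjective x
    exact (cardFactors_orderOf_l2Eleven A).1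
  -- The 220 matrices with squared trace 3 lie two over each class, so 110 classes have order 6.
  have h3 := QuotientGroup.card_preimage_mk
    (Subgroup.center (SpecialLinearGroup (Fin 2) (ZMod 11)))
    {x : L2Eleven | 2 ≤ ArithmeticFunction.cardFactors (orderOf x)}
  have h4 : QuotientGroup.mk ⁻¹' {x : L2Eleven | 2 ≤ ArithmeticFunction.cardFactors (orderOf x)} =
      {A : SpecialLinearGroup (Fin 2) (ZMod 11) | A.1.trace ^ 2 = 3} :=
    Set.ext fun A => (cardFactors_orderOf_l2Eleven A).2
  rw [h4, card_trace_sq_eq_three, card_center_sl2Eleven, Nat.card_coe_set_eq] at h3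
  rw [card_l2Eleven] at h1 h2
  omega

/-! ### Lower bound for elements of composite order -/

/-- If `u` has prime order `p` and `p ^ 2` does not divide `|G|`, then the elements of composite
order whose `p`-part is conjugate to `u` number `|G| / p - |G : C(u)|`. -/
theorem index_mul_le_ncard_composite {G : Type*} [Group G] [Finite G] {p : ℕ} [hp : Fact p.Prime]
    (u : G) (hu : orderOf u = p) (hG : ¬ p ^ 2 ∣ Nat.card G) :
    (Subgroup.centralizer {u}).index * (Nat.card (Subgroup.centralizer {u}) / p - 1) ≤
      {x : G | 2 ≤ ArithmeticFunction.cardFactors (orderOf x)}.ncard := by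
  set C := Subgroup.centralizer {u} with hC
  let u' : C := ⟨u, Subgroup.mem_centralizer_singleton_iff.2 rfl⟩
  have hcomm : ∀ x : C, x * u' = u' * x := fun x =>
    Subtype.ext (Subgroup.mem_centralizer_singleton_iff.1 x.2)
  have hu' : orderOf u' = p := by rw [← hu, ← Subgroup.orderOf_coe]
  have hnorm : (Subgroup.zpowers u').Normal := ⟨fun n hn g => by
    obtain ⟨k, rfl⟩ := Subgroup.mem_zpowers_iff.1 hn
    have : g * u' ^ k = u' ^ k * g := (Commute.zpow_right (hcomm g) k).eq
    rw [this, mul_inv_cancel_right]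
    exact Subgroup.zpow_mem_zpowers u' k⟩
  have hZ : Nat.card (Subgroup.zpowers u') = p := by rw [Nat.card_zpowers, hu']
  have hcop : Nat.Coprime p (Subgroup.zpowers u').index := by
    rw [Nat.Prime.coprime_iff_not_dvd hp.out]
    intro h
    apply hG
    refine dvd_trans ?_ (Subgroup.card_subgroup_dvd_card C)
    rw [← Subgroup.card_mul_index (Subgroup.zpowers u'), hZ, sq]
    exact mul_dvd_mul_left p h
  -- Schur–Zassenhaus: the central Hall subgroup generated by `u` has a complement `L` in its
  -- centralizer.
  obtain ⟨L, hL⟩ := Subgroup.exists_right_complement'_of_coprime (N := Subgroup.zpowers u')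
    (by rwa [hZ])
  have hLi : (Subgroup.zpowers u').index = Nat.card L := hL.symm.index_eq_card
  have hLc : Nat.card C / p = Nat.card L := by
    rw [← Subgroup.card_mul_index (Subgroup.zpowers u'), hZ, hLi,
      Nat.mul_div_cancel_left _ hp.out.pos]
  rw [hLi] at hcop
  -- The `k`-th power extracts the `p`-part: it fixes `u` and kills `L`.
  obtain ⟨k, hk1, hk0⟩ := Nat.chineseRemainder hcop 1 0
  have hLk : ∀ l : L, ((l : C) : G) ^ k = 1 := fun l => by
    obtain ⟨m, rfl⟩ := (Nat.modEq_zero_iff_dvd.1 hk0)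
    have : l ^ (Nat.card L * m) = 1 := by rw [pow_mul, pow_card_eq_one', one_pow]
    exact_mod_cast congrArg (fun x : L => ((x : C) : G)) this
  have huk : u ^ k = u := by
    rw [← pow_mod_orderOf, hu, hk1, ← hu, pow_mod_orderOf, pow_one]
  have hul : ∀ l : L, Commute u ((l : C) : G) := fun l =>
    (congrArg Subtype.val (hcomm (l : C))).symm
  let S := {x : G | 2 ≤ ArithmeticFunction.cardFactors (orderOf x)}
  let f : (G ⧸ C) × {l : L // l ≠ 1} → S := fun x =>
    ⟨x.1.out * (u * ((x.2.1 : C) : G)) * (x.1.out)⁻¹, by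
      have hl : 1 < orderOf ((x.2.1 : C) : G) := by
        rw [Subgroup.orderOf_coe, Subgroup.orderOf_coe]
        have h1 := orderOf_pos x.2.1
        have h2 : orderOf x.2.1 ≠ 1 := fun h => x.2.2 (orderOf_eq_one_iff.1 h)
        omega
      have hord : orderOf (x.1.out * (u * ((x.2.1 : C) : G)) * (x.1.out)⁻¹) =
          p * orderOf ((x.2.1 : C) : G) := by
        rw [← hu, ← (hul x.2.1).orderOf_mul_eq_mul_orderOf_of_coprime]
        · exact (MulAut.conj x.1.out).orderOf_eq _
        · rw [hu]
          refine Nat.Coprime.coprime_dvd_right ?_ hcop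
          rw [Subgroup.orderOf_coe, Subgroup.orderOf_coe]
          exact orderOf_dvd_natCard _
      show 2 ≤ _
      rw [hord, ArithmeticFunction.cardFactors_mul hp.out.ne_zero (by omega),
        ArithmeticFunction.cardFactors_apply_prime hp.out]
      have := ArithmeticFunction.cardFactors_pos_iff_one_lt.2 hl
      omega⟩
  have hf : Function.Injective f := by
    rintro ⟨q, l⟩ ⟨q', l'⟩ h
    have h : q.out * (u * ((l.1 : C) : G)) * q.out⁻¹ =
      q'.out * (u * ((l'.1 : C) : G)) * q'.out⁻¹ := congrArg Subtype.val h
    -- Equal `p`-parts are equal conjugates of `u`, which determine the coset of the centralizer.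
    have hq : q = q' := by
      have h2 := congrArg (· ^ k) h
      simp only [conj_pow, (hul _).mul_pow, hLk, huk, mul_one] at h2
      rw [← q.out_eq', ← q'.out_eq']
      refine QuotientGroup.eq.2 (Subgroup.mem_centralizer_singleton_iff.2 ?_)
      have h3 : q'.out * u = q.out * u * q.out⁻¹ * q'.out := by rw [h2]; group
      rw [mul_assoc, h3]
      group
    subst hq
    have : (l.1 : C) = l'.1 := Subtype.ext (by simpa using h)
    rw [Subtype.ext (Subtype.ext this)]
  have hcard : Nat.card {l : L // l ≠ 1} = Nat.card L - 1 := by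
    classical
    have := Fintype.ofFinite L
    rw [Nat.card_eq_fintype_card, Nat.card_eq_fintype_card, Fintype.card_subtype_compl,
      Fintype.card_subtype_eq]
  have := Nat.card_le_card_of_injective f hf
  rwa [Nat.card_prod, hcard, ← hLc, Nat.card_coe_set_eq] at this

/-! ### Sylow 11-subgroups under the bound 769 -/

section OrderSixHundredSixty

variable {G : Type*} [Group G] [Finite G]

theorem ncard_composite_le (hcard : Nat.card G = 660) (hO : OmegaRho G ≤ 769) :
    {x : G | 2 ≤ ArithmeticFunction.cardFactors (orderOf x)}.ncard ≤ 110 := by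
  have := card_add_ncard_le_omegaRho G
  omega

/-- Otherwise the index `i` of the centralizer is at most 20, and there are at least `220 - i ≥ 200
> 110` elements of composite order. -/
theorem not_dvd_card_centralizer_of_orderOf_three (hcard : Nat.card G = 660)
    (hO : OmegaRho G ≤ 769) (u : G)
    (hu : orderOf u = 3) : ¬ 33 ∣ Nat.card (Subgroup.centralizer {u}) := by
  rintro ⟨m, hm⟩
  have : Fact (Nat.Prime 3) := ⟨by norm_num⟩
  have h := index_mul_le_ncard_composite u hu (by rw [hcard]; norm_num)
  have h2 := ncard_composite_le hcard hO
  have h3 := Subgroup.card_mul_index (Subgroup.centralizer {u})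
  rw [hcard, hm] at h3
  rw [hm, show 33 * m / 3 = 11 * m by omega] at h
  generalize (Subgroup.centralizer {u}).index = i at h h3
  rw [Nat.mul_sub] at h
  have h4 : i * (11 * m) = 220 := by linarith
  have hm0 : 0 < m := Nat.pos_of_ne_zero (by rintro rfl; omega)
  have h5 : 11 * i ≤ 220 := by nlinarith
  omega

/-- Here the index is at most 12, so the count is at least `132 - 12 = 120 > 110`. -/
theorem not_dvd_card_centralizer_of_orderOf_five (hcard : Nat.card G = 660)
    (hO : OmegaRho G ≤ 769) (u : G)
    (hu : orderOf u = 5) : ¬ 55 ∣ Nat.card (Subgroup.centralizer {u}) := by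
  rintro ⟨m, hm⟩
  have : Fact (Nat.Prime 5) := ⟨by norm_num⟩
  have h := index_mul_le_ncard_composite u hu (by rw [hcard]; norm_num)
  have h2 := ncard_composite_le hcard hO
  have h3 := Subgroup.card_mul_index (Subgroup.centralizer {u})
  rw [hcard, hm] at h3
  rw [hm, show 55 * m / 5 = 11 * m by omega] at h
  generalize (Subgroup.centralizer {u}).index = i at h h3
  rw [Nat.mul_sub] at h
  have h4 : i * (11 * m) = 132 := by linarith
  have hm0 : 0 < m := Nat.pos_of_ne_zero (by rintro rfl; omega)
  have h5 : 11 * i ≤ 132 := by nlinarith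
  omega

theorem card_sylow_eleven (hcard : Nat.card G = 660) (P : Sylow 11 G) : Nat.card P = 11 := by
  rw [P.card_eq_multiplicity, hcard]
  have : (660 : ℕ).factorization 11 = 1 := by
    rw [show 660 = 11 ^ 1 * 60 by norm_num, Nat.factorization_mul (by norm_num) (by norm_num),
      Finsupp.add_apply, Nat.Prime.factorization_pow (by norm_num),
      Nat.factorization_eq_zero_of_not_dvd (by norm_num)]
    simp
  rw [this, pow_one]

/-- If `P` were normal, it would be centralized by the elements of order three. -/
theorem card_sylows_eleven_of_omegaRho_le (hcard : Nat.card G = 660) (hO : OmegaRho G ≤ 769) :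
    Nat.card (Sylow 11 G) = 12 := by
  obtain ⟨P⟩ : Nonempty (Sylow 11 G) := inferInstance
  have hP := card_sylow_eleven hcard P
  have hdvd := P.card_dvd_index
  have hidx := Subgroup.card_mul_index (P : Subgroup G)
  have hmod := card_sylow_modEq_one 11 G
  rw [hcard] at hidx
  rw [show (P : Subgroup G).index = 60 by
    have : Nat.card (P : Subgroup G) = 11 := hP
    rw [this] at hidx; omega] at hdvd
  have h12 : Nat.card (Sylow 11 G) = 1 ∨ Nat.card (Sylow 11 G) = 12 := by
    generalize Nat.card (Sylow 11 G) = n at hdvd hmod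
    have : n ≤ 60 := Nat.le_of_dvd (by norm_num) hdvd
    revert hmod hdvd
    unfold Nat.ModEq
    interval_cases n <;> simp
  refine h12.resolve_left fun h1 => ?_
  have : Subsingleton (Sylow 11 G) := (Nat.card_eq_one_iff_unique.1 h1).1
  have hn : (P : Subgroup G).Normal := P.normal_of_subsingleton
  have : Fact (Nat.Prime 3) := ⟨by norm_num⟩
  obtain ⟨u, hu⟩ := exists_prime_orderOf_dvd_card' (G := G) 3 (by rw [hcard]; norm_num)
  refine not_dvd_card_centralizer_of_orderOf_three hcard hO u hu ?_
  have hcyc : IsCyclic P := isCyclic_of_prime_card hP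
  -- The automorphism group has order prime to 3, so `u` acts trivially on `P`.
  have haut : Nat.card (MulAut P) = 10 := by
    rw [IsCyclic.card_mulAut, hP]
    rfl
  have hconj : MulAut.conjNormal (H := (P : Subgroup G)) u = 1 := by
    rw [← orderOf_eq_one_iff]
    have d1 : orderOf (MulAut.conjNormal (H := (P : Subgroup G)) u) ∣ 3 :=
      hu ▸ orderOf_map_dvd _ u
    have d2 : orderOf (MulAut.conjNormal (H := (P : Subgroup G)) u) ∣ 10 :=
      haut ▸ orderOf_dvd_natCard _
    simpa using Nat.dvd_gcd d1 d2
  have hPC : (P : Subgroup G) ≤ Subgroup.centralizer {u} := fun x hx => by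
    rw [Subgroup.mem_centralizer_singleton_iff]
    have := congrArg (fun f : MulAut (P : Subgroup G) => ((f ⟨x, hx⟩ : (P : Subgroup G)) : G)) hconj
    simp only [MulAut.conjNormal_apply, MulAut.one_apply] at this
    rw [mul_inv_eq_iff_eq_mul] at this
    exact this.symm
  have d11 : 11 ∣ Nat.card (Subgroup.centralizer {u}) :=
    hP.symm.dvd.trans (Subgroup.card_dvd_of_le hPC)
  have d3 : 3 ∣ Nat.card (Subgroup.centralizer {u}) := by
    rw [← hu]
    exact Subgroup.orderOf_dvd_natCard _ (Subgroup.mem_centralizer_singleton_iff.2 rfl)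
  omega

theorem card_normalizer_sylow_eleven (hcard : Nat.card G = 660)
    (h12 : Nat.card (Sylow 11 G) = 12) (P : Sylow 11 G) :
    Nat.card (MulAction.stabilizer G P) = 55 := by
  have h := Subgroup.card_mul_index (MulAction.stabilizer G P)
  rw [MulAction.index_stabilizer, MulAction.orbit_eq_univ, Set.ncard_univ, h12, hcard] at h
  omega

/-- The centralizer contains `P` and lies in a normalizer of order 55, so if larger it contains an
element of order 5 centralizing `P`, which the composite-order count forbids. -/
theorem centralizer_sylow_eleven_le (hcard : Nat.card G = 660)
    (hO : OmegaRho G ≤ 769) (P : Sylow 11 G) :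
    Subgroup.centralizer (P : Set G) ≤ P := by
  have hP : Nat.card (P : Subgroup G) = 11 := card_sylow_eleven hcard P
  have hcyc : IsCyclic (P : Subgroup G) := isCyclic_of_prime_card hP
  have hle : (P : Subgroup G) ≤ Subgroup.centralizer (P : Set G) :=
    Subgroup.le_centralizer (P : Subgroup G)
  have hN : Nat.card (Subgroup.centralizer (P : Set G)) ∣ 55 := by
    rw [← card_normalizer_sylow_eleven hcard (card_sylows_eleven_of_omegaRho_le hcard hO) P]
    refine Subgroup.card_dvd_of_le ?_
    rw [P.stabilizer_eq_normalizer]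
    exact Subgroup.centralizer_le_normalizer _
  have d11 : 11 ∣ Nat.card (Subgroup.centralizer (P : Set G)) :=
    hP.symm.dvd.trans (Subgroup.card_dvd_of_le hle)
  have h5 : ¬ 5 ∣ Nat.card (Subgroup.centralizer (P : Set G)) := fun h => by
    have : Fact (Nat.Prime 5) := ⟨by norm_num⟩
    obtain ⟨u, hu⟩ := exists_prime_orderOf_dvd_card' 5 h
    rw [← Subgroup.orderOf_coe] at hu
    refine not_dvd_card_centralizer_of_orderOf_five hcard hO u hu ?_
    have hPC : (P : Subgroup G) ≤ Subgroup.centralizer {(u : G)} := fun x hx =>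
      Subgroup.mem_centralizer_singleton_iff.2 (Subgroup.mem_centralizer_iff.1 u.2 x hx)
    have d11 : 11 ∣ Nat.card (Subgroup.centralizer {(u : G)}) :=
    hP.symm.dvd.trans (Subgroup.card_dvd_of_le hPC)
    have d5 : 5 ∣ Nat.card (Subgroup.centralizer {(u : G)}) := by
      rw [← hu]
      exact Subgroup.orderOf_dvd_natCard _ (Subgroup.mem_centralizer_singleton_iff.2 rfl)
    omega
  have hC : Nat.card (Subgroup.centralizer (P : Set G)) ≤ Nat.card (P : Subgroup G) := by
    rw [hP]
    obtain ⟨k, hk⟩ := d11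
    rw [hk] at hN h5 ⊢
    have hk5 : k ∣ 5 := Nat.dvd_of_mul_dvd_mul_left (by norm_num : 0 < 11) (by simpa using hN)
    rcases (Nat.dvd_prime (by norm_num)).1 hk5 with rfl | rfl
    · rfl
    · exact absurd ⟨11, by norm_num⟩ h5
  exact (Subgroup.eq_of_le_of_card_ge hle hC).ge

end OrderSixHundredSixty

/-! ### Model permutations of the projective line -/

namespace ProjLine

/-- The translation `x ↦ x + 1` of the projective line over `ZMod 11`, with `none` at infinity. -/
def translation : Equiv.Perm (Option (ZMod 11)) :=
  Equiv.optionCongr (Equiv.addRight 1)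

/-- The homothety `x ↦ 3 x` of the projective line. -/
def homothety : Equiv.Perm (Option (ZMod 11)) :=
  Equiv.optionCongr
    { toFun := fun x => 3 * x
      invFun := fun x => 4 * x
      left_inv := by unfold Function.LeftInverse; decide
      right_inv := by unfold Function.RightInverse Function.LeftInverse; decide }

/-- The maps exchanging `0` and `∞` which send `3 ^ i` to `3 ^ (j * i) * d` and `- 3 ^ i` to
`3 ^ (j * i) * e`. -/
def twistedInversion (j : ℕ) (d e : ZMod 11) : Option (ZMod 11) → Option (ZMod 11)
  | none => some 0
  | some x => if x = 0 then none else if x ^ 5 = 1 then some (x ^ j * d) else some ((-x) ^ j * e)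

/-- The inversion `x ↦ - 1 / x` of the projective line. -/
def inversion : Equiv.Perm (Option (ZMod 11)) :=
  Function.Involutive.toPerm (twistedInversion 4 (-1) 1) (by unfold Function.Involutive; decide)

/-- The subgroup of permutations of the projective line generated by the translation, the homothety
and the inversion. -/
def group : Subgroup (Equiv.Perm (Option (ZMod 11))) :=
  Subgroup.closure {translation, homothety, inversion}

theorem translation_pow (n : ℕ) (x : ZMod 11) :
    (translation ^ n) (some x) = some (x + n) := by
  induction n with
  | zero => simp
  | succ n ih =>
    rw [pow_succ', Equiv.Perm.mul_apply, ih]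
    simp [translation, add_assoc]

theorem translation_pow_none (n : ℕ) : (translation ^ n) none = none := by
  induction n with
  | zero => simp
  | succ n ih =>
    rw [pow_succ', Equiv.Perm.mul_apply, ih]
    simp [translation]

theorem homothety_pow (n : ℕ) (x : ZMod 11) :
    (homothety ^ n) (some x) = some (3 ^ n * x) := by
  induction n with
  | zero => simp
  | succ n ih =>
    rw [pow_succ', Equiv.Perm.mul_apply, ih]
    simp [homothety, pow_succ', mul_assoc]

theorem homothety_pow_none (n : ℕ) : (homothety ^ n) none = none := by
  induction n with
  | zero => simp
  | succ n ih =>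
    rw [pow_succ', Equiv.Perm.mul_apply, ih]
    simp [homothety]

theorem exists_pow_three (x : ZMod 11) (hx : x ≠ 0) :
    (x ^ 5 = 1 ∧ ∃ i < 5, x = 3 ^ i) ∨ (x ^ 5 ≠ 1 ∧ ∃ i < 5, x = -3 ^ i) := by
  revert x
  decide

/-- A fixed-point free involution of the projective line inverting the homotheties is the inversion
up to a homothety. -/
theorem twistedInversion_four (d e : ZMod 11)
    (h1 : ∀ x, twistedInversion 4 d e (twistedInversion 4 d e x) = x)
    (h2 : ∀ x, twistedInversion 4 d e x ≠ x) :
    ∃ k < 5, ∀ x, twistedInversion 4 d e x = (homothety ^ k) (inversion x) := by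
  revert d e
  decide +kernel

/-- A fixed-point free involution of the projective line centralizing the homotheties generates
together with the translations a group in which some nontrivial element fixes `0`, `1`, `∞`. -/
theorem twistedInversion_one (d e : ZMod 11)
    (h1 : ∀ x, twistedInversion 1 d e (twistedInversion 1 d e x) = x)
    (h2 : ∀ x, twistedInversion 1 d e x ≠ x) :
    ∃ v ∈ [(0, 1, 5, 3), (0, 2, 10, 6), (2, 9, 5, 8), (3, 3, 1, 7), (1, 1, 1, 0)],
      ∃ f : Option (ZMod 11) → Option (ZMod 11),
      (f = fun x => (translation ^ v.1) (twistedInversion 1 d e ((translation ^ v.2.1)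
        (twistedInversion 1 d e ((translation ^ v.2.2.1) (twistedInversion 1 d e
          ((translation ^ v.2.2.2) x))))))) ∧
      f none = none ∧ f (some 0) = some 0 ∧ f (some 1) = some 1 ∧ ∃ x, f x ≠ x := by
  -- Substituting `f` away makes the claim decidable. The hypotheses leave only the five pairs `d =
  -- -3 ^ k`, `e = 3 ^ (-k)`; each `v` lists the translation exponents of a word.
  suffices ∃ v ∈ [(0, 1, 5, 3), (0, 2, 10, 6), (2, 9, 5, 8), (3, 3, 1, 7), (1, 1, 1, 0)],
      let f : Option (ZMod 11) → Option (ZMod 11) :=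
        fun x => (translation ^ v.1) (twistedInversion 1 d e ((translation ^ v.2.1)
        (twistedInversion 1 d e ((translation ^ v.2.2.1) (twistedInversion 1 d e
          ((translation ^ v.2.2.2) x))))))
      f none = none ∧ f (some 0) = some 0 ∧ f (some 1) = some 1 ∧ ∃ x, f x ≠ x by
    obtain ⟨v, hv, h⟩ := this
    exact ⟨v, hv, _, rfl, h⟩
  revert d e
  decide +kernel

/-! ### Recognition from the action on the projective line -/

section Recognition

variable {G : Type*} [Group G] (φ : G →* Equiv.Perm (Option (ZMod 11))) (p h : G)

/-- The homotheties have two orbits on nonzero points, those of 1 and -1. The relation between `w`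
and `h` therefore determines `w` from its values `d`, `e` there. -/
theorem eq_twistedInversion (w : G) (j : ℕ) (hh : φ h = homothety)
    (hj : w * h = h ^ j * w) (h0 : φ w none = some 0) (h1 : φ w (some 0) = none) :
    ∃ d e, ∀ x, φ w x = twistedInversion j d e x := by
  have key : ∀ (i : ℕ) (x : ZMod 11),
      φ w (some (3 ^ i * x)) = (homothety ^ (j * i)) (φ w (some x)) := by
    intro i x
    have : ∀ i : ℕ, w * h ^ i = h ^ (j * i) * w := fun i => by
      rw [pow_mul]
      exact SemiconjBy.pow_right hj i
    rw [← homothety_pow, ← hh, ← map_pow, ← map_pow, ← Equiv.Perm.mul_apply,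
      ← Equiv.Perm.mul_apply, ← map_mul, ← map_mul, this]
  have hne : ∀ x : ZMod 11, x ≠ 0 → ∃ d, φ w (some x) = some d := fun x hx =>
    Option.ne_none_iff_exists'.1 fun hn => by
      rw [← h1] at hn
      exact hx (Option.some_injective _ ((φ w).injective hn))
  obtain ⟨d, hd⟩ := hne 1 (by decide)
  obtain ⟨e, he⟩ := hne (-1) (by decide)
  refine ⟨d, e, fun x => ?_⟩
  rcases x with _ | x
  · rw [h0, twistedInversion]
  · by_cases hx : x = 0
    · rw [hx, h1, twistedInversion, if_pos rfl]
    · rcases exists_pow_three x hx with ⟨h5, i, -, rfl⟩ | ⟨h5, i, -, rfl⟩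
      · have := key i 1
        rw [mul_one, hd, homothety_pow] at this
        rw [this, twistedInversion, if_neg hx, if_pos h5, ← pow_mul, mul_comm i j]
      · have := key i (-1)
        rw [mul_neg, mul_one, he, homothety_pow] at this
        rw [this, twistedInversion, if_neg hx, if_neg h5, neg_neg, ← pow_mul, mul_comm i j]

theorem eq_one_of_fixes
    (hh : φ h = homothety) (h5 : h ^ 5 = 1)
    (hstab : ∀ g, φ g none = none → φ g (some 0) = some 0 → ∃ k : ℕ, g = h ^ k)
    (g : G) (h0 : φ g none = none) (h1 : φ g (some 0) = some 0)
    (h2 : φ g (some 1) = some 1) : g = 1 := by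
  obtain ⟨k, rfl⟩ := hstab g h0 h1
  rw [← Nat.mod_add_div k 5, pow_add, pow_mul, h5, one_pow, mul_one] at h2 ⊢
  have hk : k % 5 < 5 := Nat.mod_lt _ (by norm_num)
  rw [map_pow, hh, homothety_pow, mul_one] at h2
  have key : ∀ i < 5, some ((3 : ZMod 11) ^ i) = some 1 → i = 0 := by decide
  rw [key _ hk h2, pow_zero]

theorem mem_of_fixes_none
    (hp : φ p = translation)
    (hstab : ∀ g, φ g none = none → φ g (some 0) = some 0 → ∃ k : ℕ, g = h ^ k)
    (S : Subgroup G) (hpS : p ∈ S) (hhS : h ∈ S) (g : G)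
    (h0 : φ g none = none) : g ∈ S := by
  obtain ⟨x, hx⟩ : ∃ x, φ g (some 0) = some x := Option.ne_none_iff_exists'.1 fun hn => by
    rw [← h0] at hn
    cases (φ g).injective hn
  have e0 : φ ((p ^ x.val)⁻¹ * g) none = none := by
    rw [map_mul, map_inv, Equiv.Perm.mul_apply, h0, Equiv.Perm.inv_eq_iff_eq, map_pow, hp,
      translation_pow_none]
  have e1 : φ ((p ^ x.val)⁻¹ * g) (some 0) = some 0 := by
    rw [map_mul, map_inv, Equiv.Perm.mul_apply, hx, Equiv.Perm.inv_eq_iff_eq, map_pow, hp,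
      translation_pow, ZMod.natCast_zmod_val, zero_add]
  obtain ⟨k, hk⟩ := hstab _ e0 e1
  rw [inv_mul_eq_iff_eq_mul] at hk
  rw [hk]
  exact S.mul_mem (S.pow_mem hpS _) (S.pow_mem hhS _)

/-- Translations move 0 to any finite point and `w` moves ∞ to 0, so every element reduces to one
fixing ∞. -/
theorem closure_eq_top
    (hp : φ p = translation)
    (hstab : ∀ g, φ g none = none → φ g (some 0) = some 0 → ∃ k : ℕ, g = h ^ k)
    (w : G) (hw : φ w none = some 0) :
    Subgroup.closure {p, h, w} = ⊤ := by
  have hpS : p ∈ Subgroup.closure {p, h, w} := Subgroup.subset_closure (by simp)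
  have hhS : h ∈ Subgroup.closure {p, h, w} := Subgroup.subset_closure (by simp)
  have hwS : w ∈ Subgroup.closure {p, h, w} := Subgroup.subset_closure (by simp)
  refine Subgroup.eq_top_iff' _ |>.2 fun g => ?_
  rcases hg : φ g none with _ | x
  · exact mem_of_fixes_none φ p h hp hstab _ hpS hhS g hg
  · have e0 : φ ((p ^ x.val * w)⁻¹ * g) none = none := by
      rw [map_mul, map_inv, Equiv.Perm.mul_apply, hg, Equiv.Perm.inv_eq_iff_eq, map_mul,
        Equiv.Perm.mul_apply, hw, map_pow, hp, translation_pow, ZMod.natCast_zmod_val, zero_add]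
    have := mem_of_fixes_none φ p h hp hstab _ hpS hhS _ e0
    exact (Subgroup.mul_mem_cancel_left _
      (inv_mem (mul_mem (pow_mem hpS _) hwS))).1 this

/-- An involution exchanging `0` and `∞`. -/
theorem exists_swap
    (hp : φ p = translation) (h5 : h ^ 5 = 1)
    (hstab : ∀ g, φ g none = none → φ g (some 0) = some 0 → ∃ k : ℕ, g = h ^ k)
    (htrans : ∃ g, φ g none ≠ none) :
    ∃ w, w ^ 2 = 1 ∧ φ w none = some 0 ∧ φ w (some 0) = none := by
  have hpt : ∀ x : ZMod 11, φ (p ^ x.val) (some 0) = some x ∧ φ (p ^ x.val) none = none :=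
    fun x => by
      rw [map_pow, hp, translation_pow, translation_pow_none, ZMod.natCast_zmod_val, zero_add]
      exact ⟨rfl, rfl⟩
  obtain ⟨g, hg⟩ : ∃ g, φ g none = some 0 := by
    obtain ⟨g, hg⟩ := htrans
    obtain ⟨x, hx⟩ := Option.ne_none_iff_exists'.1 hg
    refine ⟨(p ^ x.val)⁻¹ * g, ?_⟩
    rw [map_mul, map_inv, Equiv.Perm.mul_apply, hx, Equiv.Perm.inv_eq_iff_eq, (hpt x).1]
  obtain ⟨y, hy⟩ : ∃ y, (φ g)⁻¹ none = some y := Option.ne_none_iff_exists'.1 fun hn => by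
    rw [Equiv.Perm.inv_eq_iff_eq, hg] at hn
    cases hn
  set v := g * p ^ y.val with hv
  have hv0 : φ v none = some 0 := by
    rw [hv, map_mul, Equiv.Perm.mul_apply, (hpt y).2, hg]
  have hv1 : φ v (some 0) = none := by
    rw [hv, map_mul, Equiv.Perm.mul_apply, (hpt y).1]
    exact (Equiv.Perm.inv_eq_iff_eq.1 hy).symm
  have hvv0 : φ (v ^ 2) none = none := by
    rw [sq, map_mul, Equiv.Perm.mul_apply, hv0, hv1]
  have hvv1 : φ (v ^ 2) (some 0) = some 0 := by
    rw [sq, map_mul, Equiv.Perm.mul_apply, hv1, hv0]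
  obtain ⟨k, hk⟩ := hstab _ hvv0 hvv1
  -- Since `v ^ 2` is a power of `h`, its fifth power is trivial; the odd power `v ^ 5` still swaps
  -- 0 and ∞.
  refine ⟨v ^ 5, ?_, ?_, ?_⟩
  · rw [← pow_mul, mul_comm, pow_mul, hk, ← pow_mul, mul_comm, pow_mul, h5, one_pow]
  · rw [show v ^ 5 = v * v ^ 2 * v ^ 2 by group, map_mul, map_mul, Equiv.Perm.mul_apply,
      Equiv.Perm.mul_apply, hvv0, hvv0, hv0]
  · rw [show v ^ 5 = v * v ^ 2 * v ^ 2 by group, map_mul, map_mul, Equiv.Perm.mul_apply,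
      Equiv.Perm.mul_apply, hvv1, hvv1, hv1]

theorem exists_inversion
    (hp : φ p = translation) (hh : φ h = homothety) (h5 : h ^ 5 = 1)
    (hstab : ∀ g, φ g none = none → φ g (some 0) = some 0 → ∃ k : ℕ, g = h ^ k)
    (htrans : ∃ g, φ g none ≠ none)
    (hfree : ∀ g x, g ^ 2 = 1 → φ g x = x → g = 1) : ∃ w, φ w = inversion := by
  obtain ⟨w, hw2, hw0, hw1⟩ := exists_swap φ p h hp h5 hstab htrans
  have hww : ∀ x, φ w (φ w x) = x := fun x => by
    rw [← Equiv.Perm.mul_apply, ← map_mul, ← sq, hw2, map_one, Equiv.Perm.one_apply]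
  have hfix : ∀ x, φ w x ≠ x := fun x hx => by
    rw [hfree w x hw2 hx, map_one] at hw0
    cases hw0
  have hh0 : φ h none = none := by simpa [hh] using homothety_pow_none 1
  have hh1 : φ h (some 0) = some 0 := by simpa [hh] using homothety_pow 1 0
  obtain ⟨k, hk⟩ := hstab (w * h * w)
    (by simp [map_mul, Equiv.Perm.mul_apply, hw0, hw1, hh1])
    (by simp [map_mul, Equiv.Perm.mul_apply, hw0, hw1, hh0])
  have hcomm : w * h = h ^ (k % 5) * w := by
    rw [← Nat.mod_add_div k 5, pow_add, pow_mul, h5, one_pow, mul_one] at hk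
    rw [← hk, mul_assoc (w * h), ← sq, hw2, mul_one]
  have hk5 : k % 5 < 5 := Nat.mod_lt _ (by norm_num)
  generalize k % 5 = j at hcomm hk5
  -- conjugating twice by `w` raises `h` to the power `j ^ 2`
  have hj2 : some ((3 : ZMod 11) ^ (j * j)) = some 3 := by
    have h1 : w * h ^ j = h ^ (j * j) * w := by
      rw [pow_mul]
      exact SemiconjBy.pow_right hcomm j
    have h2 : h = h ^ (j * j) := by
      have : w * (w * h) = h ^ (j * j) * (w * w) := by
        rw [hcomm, ← mul_assoc, h1, mul_assoc]
      rwa [← mul_assoc, ← sq, hw2, one_mul, mul_one] at this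
    have h3 := congrArg (fun g => φ g (some 1)) h2
    simp only [map_pow, hh, homothety_pow, mul_one] at h3
    rw [← h3]
    simpa using homothety_pow 1 1
  obtain ⟨d, e, hde⟩ := eq_twistedInversion φ h w j hh hcomm hw0 hw1
  -- As 3 has order 5 modulo 11, `j ^ 2` is 1 modulo 5: `w` centralizes or inverts `h`.
  have hj : j = 1 ∨ j = 4 := by
    revert hj2
    clear hde hcomm
    revert j
    decide
  rcases hj with rfl | rfl
  · exfalso
    obtain ⟨v, -, f, hf, hf0, hf1, hf2, x, hx⟩ := twistedInversion_one d e
      (fun x => by rw [← hde, ← hde, hww]) (fun x => by rw [← hde]; exact hfix x)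
    have hφ : ∀ x, φ (p ^ v.1 * w * p ^ v.2.1 * w * p ^ v.2.2.1 * w * p ^ v.2.2.2) x = f x := by
      intro x
      simp only [map_mul, map_pow, Equiv.Perm.mul_apply, hp, hde, hf]
    have := eq_one_of_fixes φ h hh h5 hstab _ ((hφ _).trans hf0) ((hφ _).trans hf1)
      ((hφ _).trans hf2)
    rw [← hφ, this, map_one] at hx
    exact hx rfl
  · obtain ⟨k, -, hk⟩ := twistedInversion_four d e
      (fun x => by rw [← hde, ← hde, hww]) (fun x => by rw [← hde]; exact hfix x)
    refine ⟨(h ^ k)⁻¹ * w, Equiv.ext fun x => ?_⟩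
    rw [map_mul, map_inv, Equiv.Perm.mul_apply, Equiv.Perm.inv_eq_iff_eq, hde, hk, map_pow, hh]

/-- A group acting on the projective line like `PSL(2, 11)` is determined up to isomorphism. -/
theorem nonempty_mulEquiv_group
    (hp : φ p = translation) (hh : φ h = homothety) (h5 : h ^ 5 = 1)
    (hstab : ∀ g, φ g none = none → φ g (some 0) = some 0 → ∃ k : ℕ, g = h ^ k)
    (htrans : ∃ g, φ g none ≠ none)
    (hfree : ∀ g x, g ^ 2 = 1 → φ g x = x → g = 1) : Nonempty (G ≃* group) := by
  obtain ⟨w, hw⟩ := exists_inversion φ p h hp hh h5 hstab htrans hfree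
  have hinj : Function.Injective φ := (injective_iff_map_eq_one φ).2 fun g hg =>
    eq_one_of_fixes φ h hh h5 hstab g (by rw [hg]; rfl) (by rw [hg]; rfl) (by rw [hg]; rfl)
  have hrange : φ.range = group := by
    rw [MonoidHom.range_eq_map, ← closure_eq_top φ p h hp hstab w (by rw [hw]; rfl),
      MonoidHom.map_closure, Set.image_insert_eq, Set.image_pair, hp, hh, hw, group]
  exact ⟨(MonoidHom.ofInjective hinj).trans (MulEquiv.subgroupCongr hrange)⟩

end Recognition

end ProjLine

/-! ### Projective line structure on the Sylow 11-subgroups -/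

section SylowAction

variable {G : Type*} [Group G] [Finite G]

/-- A Sylow `11`-subgroup is generated by any element of order eleven normalizing it. -/
theorem eq_zpowers_of_smul_eq
    (hcard : Nat.card G = 660)
    (Q : Sylow 11 G) (x : G) (hx : orderOf x = 11) (hQ : x • Q = Q) :
    (Q : Subgroup G) = Subgroup.zpowers x := by
  have hz : Nat.card (Subgroup.zpowers x) = 11 := by rw [Nat.card_zpowers, hx]
  have hpg : IsPGroup 11 (Subgroup.zpowers x) := IsPGroup.of_card (n := 1) (by rw [hz, pow_one])
  have h1 := hpg.inf_normalizer_sylow Q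
  have hN : Subgroup.zpowers x ≤ Subgroup.normalizer (Q : Set G) := by
    rw [Subgroup.zpowers_le, ← Q.stabilizer_eq_normalizer]
    exact hQ
  have h2 : Subgroup.zpowers x ≤ Q := by
    rw [inf_eq_left.2 hN] at h1
    exact inf_eq_left.1 h1.symm
  exact (Subgroup.eq_of_le_of_card_ge h2 (by rw [hz]; exact (card_sylow_eleven hcard Q).le)).symm

theorem eq_of_orderOf_eleven_of_smul_eq
    (hcard : Nat.card G = 660)
    (P Q : Sylow 11 G) (x : G) (hx : orderOf x = 11)
    (hP : x • P = P) (hQ : x • Q = Q) : P = Q :=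
  Sylow.ext ((eq_zpowers_of_smul_eq hcard P x hx hP).trans
    (eq_zpowers_of_smul_eq hcard Q x hx hQ).symm)

/-- An element of order five in the normalizer of `P` normalizes a second Sylow subgroup. -/
theorem exists_orderOf_five_fixing_pair
    (hcard : Nat.card G = 660) (h12 : Nat.card (Sylow 11 G) = 12)
    (P : Sylow 11 G) :
    ∃ (h : G) (Q : Sylow 11 G), orderOf h = 5 ∧ Q ≠ P ∧ h • P = P ∧ h • Q = Q := by
  have : Fact (Nat.Prime 5) := ⟨by norm_num⟩
  obtain ⟨h, hh⟩ := exists_prime_orderOf_dvd_card' (G := MulAction.stabilizer G P) 5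
    (by rw [card_normalizer_sylow_eleven hcard h12]; norm_num)
  rw [← Subgroup.orderOf_coe] at hh
  have hpg : IsPGroup 5 (Subgroup.zpowers (h : G)) :=
    IsPGroup.of_card (n := 1) (by rw [Nat.card_zpowers, hh, pow_one])
  -- As 12 is 2 modulo 5, `P` cannot be the only fixed point.
  have hmod := hpg.card_modEq_card_fixedPoints (Sylow 11 G)
  rw [h12] at hmod
  have hfix : ∀ Q : Sylow 11 G, Q ∈ MulAction.fixedPoints (Subgroup.zpowers (h : G)) (Sylow 11 G) →
      (h : G) • Q = Q := fun Q hQ => hQ ⟨h, Subgroup.mem_zpowers _⟩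
  have : ∃ Q ∈ MulAction.fixedPoints (Subgroup.zpowers (h : G)) (Sylow 11 G), Q ≠ P := by
    by_contra! hc
    have hle : (MulAction.fixedPoints (Subgroup.zpowers (h : G)) (Sylow 11 G)).ncard ≤ 1 :=
      (Set.ncard_le_one_iff).2 fun ha hb => (hc _ ha).trans (hc _ hb).symm
    rw [Nat.card_coe_set_eq] at hmod
    unfold Nat.ModEq at hmod
    omega
  obtain ⟨Q, hQ, hne⟩ := this
  exact ⟨h, Q, hh, hne, h.2, hfix Q hQ⟩

/-- The two-point stabilizer has order dividing 55 and not divisible by 11, because an element of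
order 11 normalizes only one Sylow 11-subgroup. -/
theorem mem_zpowers_of_fixes_pair
    (hcard : Nat.card G = 660) (h12 : Nat.card (Sylow 11 G) = 12)
    (P Q : Sylow 11 G) (hne : Q ≠ P) (h : G) (hh : orderOf h = 5)
    (hP : h • P = P) (hQ : h • Q = Q) (g : G) (gP : g • P = P) (gQ : g • Q = Q) :
    g ∈ Subgroup.zpowers h := by
  set H := MulAction.stabilizer G P ⊓ MulAction.stabilizer G Q
  have hle : Subgroup.zpowers h ≤ H := Subgroup.zpowers_le.2 ⟨hP, hQ⟩
  have hz : Nat.card (Subgroup.zpowers h) = 5 := by rw [Nat.card_zpowers, hh]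
  have hd : Nat.card H ∣ 5 * 11 := by
    rw [show 5 * 11 = 55 by norm_num, ← card_normalizer_sylow_eleven hcard h12 P]
    exact Subgroup.card_dvd_of_le inf_le_left
  have hc : Nat.Coprime (Nat.card H) 11 := by
    rw [Nat.coprime_comm, Nat.Prime.coprime_iff_not_dvd (by norm_num)]
    intro hdvd
    obtain ⟨x, hx⟩ := exists_prime_orderOf_dvd_card' 11 hdvd
    rw [← Subgroup.orderOf_coe] at hx
    exact hne (eq_of_orderOf_eleven_of_smul_eq hcard Q P x hx x.2.2 x.2.1)
  have h5 : Nat.card H ≤ Nat.card (Subgroup.zpowers h) := by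
    rw [hz]
    exact Nat.le_of_dvd (by norm_num) (hc.dvd_of_dvd_mul_right hd)
  rw [Subgroup.eq_of_le_of_card_ge hle h5]
  exact ⟨gP, gQ⟩

/-- Conjugation by `h` raises `p` to a power `a` of order 5 modulo 11, nontrivial because `P` is
self-centralizing. Since 3 also has order 5, it is a power of `a`. -/
theorem exists_conj_eq_pow_three
    (hcard : Nat.card G = 660)
    (P : Sylow 11 G) (hC : Subgroup.centralizer (P : Set G) ≤ P)
    (p : G) (hpP : (P : Subgroup G) = Subgroup.zpowers p) (hp : orderOf p = 11)
    (h : G) (hh : orderOf h = 5) (hP : h • P = P) :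
    ∃ i : ℕ, orderOf (h ^ i) = 5 ∧ h ^ i * p = p ^ 3 * h ^ i := by
  have hmem : h * p * h⁻¹ ∈ Subgroup.zpowers p := by
    have hN : h ∈ Subgroup.normalizer (P : Set G) := by
      rw [← P.stabilizer_eq_normalizer]
      exact hP
    rw [← hpP]
    exact (Subgroup.mem_normalizer_iff.1 hN p).1 (hpP ▸ Subgroup.mem_zpowers p)
  obtain ⟨a, ha⟩ := (Submonoid.mem_powers_iff _ _).1 (mem_powers_iff_mem_zpowers.2 hmem)
  have hsemi : h * p = p ^ a * h := by rw [ha]; group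
  have hpow : ∀ i : ℕ, h ^ i * p = p ^ (a ^ i) * h ^ i := fun i => by
    induction i with
    | zero => simp
    | succ i ih =>
      have : h * p ^ (a ^ i) = p ^ (a ^ (i + 1)) * h := by
        rw [pow_succ' a, pow_mul]
        exact SemiconjBy.pow_right hsemi _
      rw [pow_succ', mul_assoc, ih, ← mul_assoc, this, mul_assoc]
  have hcast : ∀ m n : ℕ, p ^ m = p ^ n ↔ (m : ZMod 11) = n := fun m n => by
    rw [pow_eq_pow_iff_modEq, hp, ZMod.natCast_eq_natCast_iff]
  have ha5 : (a : ZMod 11) ^ 5 = 1 := by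
    have := hpow 5
    rw [← hh, pow_orderOf_eq_one, hh, one_mul, mul_one] at this
    have := (hcast 1 (a ^ 5)).1 (by rw [pow_one]; exact this)
    push_cast at this
    exact this.symm
  have ha1 : (a : ZMod 11) ≠ 1 := fun h1 => by
    have e : p ^ a = p := by simpa using (hcast a 1).2 (by simpa using h1)
    rw [e] at hsemi
    have hmem : h ∈ Subgroup.centralizer (P : Set G) := by
      have : (P : Set G) = (Subgroup.zpowers p : Set G) := congrArg SetLike.coe hpP
      rw [this, Subgroup.mem_centralizer_iff]
      rintro _ ⟨k, rfl⟩
      exact ((show Commute h p from hsemi).zpow_right k).eq.symm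
    have hd := Subgroup.orderOf_dvd_natCard _ (hC hmem)
    have : Nat.card (P : Subgroup G) = 11 := card_sylow_eleven hcard P
    rw [this, hh] at hd
    norm_num at hd
  have key : ∀ b : ZMod 11, b ^ 5 = 1 → b ≠ 1 → ∃ i < 5, Nat.Coprime 5 i ∧ b ^ i = 3 := by decide
  obtain ⟨i, -, hi, hai⟩ := key _ ha5 ha1
  refine ⟨i, ?_, ?_⟩
  · rw [Nat.Coprime.orderOf_pow (by rwa [hh]), hh]
  · rw [hpow, (hcast (a ^ i) 3).2 (by push_cast; exact hai)]

/-- The points of the projective line as the Sylow `11`-subgroups: infinity is `P`, and `i` is the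
conjugate of `Q` by `p ^ i`. -/
theorem exists_equiv_sylow
    (hcard : Nat.card G = 660) (h12 : Nat.card (Sylow 11 G) = 12)
    (P Q : Sylow 11 G) (hne : Q ≠ P) (p : G) (hp : orderOf p = 11)
    (hpP : p • P = P) :
    ∃ e : Option (ZMod 11) ≃ Sylow 11 G, e none = P ∧ ∀ n : ℕ, e (some n) = p ^ n • Q := by
  have hpn : ∀ n : ℕ, p ^ n • P = P := fun n =>
    (MulAction.stabilizer G P).pow_mem (show p ∈ MulAction.stabilizer G P from hpP) n
  have hfree : ∀ n : ℕ, p ^ n • Q = Q → (n : ZMod 11) = 0 := fun n hn => by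
    by_contra h0
    refine hne (eq_of_orderOf_eleven_of_smul_eq hcard Q P (p ^ n) ?_ hn (hpn n))
    rw [Nat.Coprime.orderOf_pow, hp]
    rw [hp, Nat.Prime.coprime_iff_not_dvd (by norm_num)]
    exact fun hd => h0 ((ZMod.natCast_eq_zero_iff n 11).2 hd)
  let f : Option (ZMod 11) → Sylow 11 G := fun x => x.elim P fun i => p ^ i.val • Q
  have hP : ∀ n : ℕ, p ^ n • Q ≠ P := fun n h => hne (by
    rw [← hpn n] at h
    exact MulAction.injective _ h)
  have hf : Function.Injective f := by
    rintro (_ | i) (_ | j) hij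
    · rfl
    · exact absurd hij.symm (hP _)
    · exact absurd hij (hP _)
    · have hij : p ^ i.val • Q = p ^ j.val • Q := hij
      -- The exponent `11 - j.val` stands for `-j`, keeping exponents natural.
      have h1 : p ^ ((11 - j.val) + i.val) • Q = Q := by
        rw [pow_add, mul_smul, hij, ← mul_smul, ← pow_add,
          Nat.sub_add_cancel (ZMod.val_lt j).le, orderOf_dvd_iff_pow_eq_one.1 hp.dvd, one_smul]
      have h2 := hfree _ h1
      rw [Nat.cast_add, Nat.cast_sub (ZMod.val_lt j).le] at h2
      simp only [ZMod.natCast_zmod_val, ZMod.natCast_self, zero_sub] at h2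
      rw [neg_add_eq_zero.1 h2]
  have hbij : Function.Bijective f := by
    rw [Nat.bijective_iff_injective_and_card]
    exact ⟨hf, by rw [h12, Nat.card_eq_fintype_card, Fintype.card_option, ZMod.card]⟩
  refine ⟨Equiv.ofBijective f hbij, rfl, fun n => ?_⟩
  show p ^ (n : ZMod 11).val • Q = _
  rw [ZMod.val_natCast, show p ^ (n % 11) = p ^ n by rw [← hp, pow_mod_orderOf]]

end SylowAction

/-! ### Identification of the group and conclusion -/

theorem nonempty_mulEquiv_projLine_group {G : Type*} [Group G] [Finite G]
    (hcard : Nat.card G = 660) (hO : OmegaRho G ≤ 769) : Nonempty (G ≃* ProjLine.group) := by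
  have h12 := card_sylows_eleven_of_omegaRho_le hcard hO
  obtain ⟨P⟩ : Nonempty (Sylow 11 G) := inferInstance
  have hC := centralizer_sylow_eleven_le hcard hO P
  obtain ⟨p, hp⟩ := exists_prime_orderOf_dvd_card' (G := P) 11 (card_sylow_eleven hcard P).symm.dvd
  rw [← Subgroup.orderOf_coe] at hp
  have hpP : (p : G) • P = P :=
    Sylow.smul_eq_iff_mem_normalizer.2 (Subgroup.le_normalizer p.2)
  obtain ⟨h', Q, hh', hne, hP', hQ'⟩ := exists_orderOf_five_fixing_pair hcard h12 P
  obtain ⟨i, hh, hconj⟩ := exists_conj_eq_pow_three hcard P hC p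
    (eq_zpowers_of_smul_eq hcard P p hp hpP) hp h' hh' hP'
  have hP : h' ^ i • P = P := (MulAction.stabilizer G P).pow_mem hP' i
  have hQ : h' ^ i • Q = Q := (MulAction.stabilizer G Q).pow_mem hQ' i
  generalize h' ^ i = h at hh hconj hP hQ
  obtain ⟨e, e0, e1⟩ := exists_equiv_sylow hcard h12 P Q hne p hp hpP
  have e1' : e (some 0) = Q := by simpa using e1 0
  let φ : G →* Equiv.Perm (Option (ZMod 11)) :=
    (e.symm.permCongrHom : _ →* _).comp (MulAction.toPermHom G (Sylow 11 G))
  have hφ : ∀ g x y, φ g x = y ↔ g • e x = e y := fun g x y => by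
    show e.symm (g • e x) = y ↔ _
    rw [Equiv.symm_apply_eq]
  have hcase : ∀ {σ τ : Equiv.Perm (Option (ZMod 11))}, σ none = τ none →
      (∀ n : ℕ, σ (some n) = τ (some n)) → σ = τ := fun {σ τ} h0 h1 => Equiv.ext fun x => by
    rcases x with _ | x
    · exact h0
    · rw [← ZMod.natCast_zmod_val x, h1]
  have hht : φ h = ProjLine.homothety := hcase
    (by rw [hφ, e0, hP]; exact e0.symm) fun n => by
      rw [hφ, e1]
      have : (ProjLine.homothety (some (n : ZMod 11))) = some ((3 * n : ℕ) : ZMod 11) := by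
        simp [ProjLine.homothety]
      rw [this, e1, ← mul_smul, pow_mul, show h * (p : G) ^ n = (p ^ 3 : G) ^ n * h from
        SemiconjBy.pow_right hconj n, mul_smul, hQ]
  have hpt : φ p = ProjLine.translation := hcase
    (by rw [hφ, e0, hpP]; exact e0.symm) fun n => by
      rw [hφ, e1]
      have : (ProjLine.translation (some (n : ZMod 11))) = some ((n + 1 : ℕ) : ZMod 11) := by
        simp [ProjLine.translation]
      rw [this, e1, pow_succ', mul_smul]
  refine ProjLine.nonempty_mulEquiv_group φ p h hpt hht (hh ▸ pow_orderOf_eq_one h) ?_ ?_ ?_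
  · intro g g0 g1
    rw [hφ, e0] at g0
    rw [hφ, e1'] at g1
    obtain ⟨k, hk⟩ := (Submonoid.mem_powers_iff _ _).1 (mem_powers_iff_mem_zpowers.2
      (mem_zpowers_of_fixes_pair hcard h12 P Q hne h hh hP hQ g g0 g1))
    exact ⟨k, hk.symm⟩
  · obtain ⟨g, hg⟩ := MulAction.exists_smul_eq G P Q
    refine ⟨g, fun h0 => hne ?_⟩
    rw [hφ, e0, hg] at h0
    exact h0
  -- Point stabilizers have odd order 55, so involutions act without fixed points.
  · intro g x hg hx
    rw [hφ] at hx
    have d55 : orderOf g ∣ 55 := by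
      rw [← card_normalizer_sylow_eleven hcard h12 (e x)]
      exact Subgroup.orderOf_dvd_natCard _ hx
    rw [← orderOf_eq_one_iff]
    simpa using Nat.dvd_gcd (orderOf_dvd_of_pow_eq_one hg) d55

theorem mainTheorem6 :
    OmegaRho L2Eleven = 769 ∧
      ∀ (G : Type*) [Group G] [Finite G], Nat.card G = 660 →
        OmegaRho L2Eleven ≤ OmegaRho G ∧
          (OmegaRho G = 769 ↔ Nonempty (G ≃* L2Eleven)) := by
  refine ⟨omegaRho_l2Eleven, fun G _ _ hcard => ?_⟩
  have hiso : OmegaRho G ≤ 769 → Nonempty (G ≃* L2Eleven) := fun hO => by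
    obtain ⟨e⟩ := nonempty_mulEquiv_projLine_group hcard hO
    -- Applying the recognition to `L2Eleven` itself avoids a direct comparison with the permutation
    -- group.
    obtain ⟨e'⟩ := nonempty_mulEquiv_projLine_group card_l2Eleven omegaRho_l2Eleven.le
    exact ⟨e.trans e'.symm⟩
  refine ⟨?_, fun h => hiso h.le, fun ⟨e⟩ => (omegaRho_congr e).trans omegaRho_l2Eleven⟩
  rw [omegaRho_l2Eleven]
  by_contra! hlt
  obtain ⟨e⟩ := hiso hlt.le
  rw [omegaRho_congr e, omegaRho_l2Eleven] at hlt
  exact lt_irrefl _ hlt
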